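/- Let $d,n\ge 1$ be integers and let $\mu,\nu$ be Borel probability measures on $\mathbb{R}^d$ (with the Euclidean norm $\lVert\cdot\rVert$) that are both supported in a common subset of $\mathbb{R}^d$ of diameter at most $1$. For Borel probability measures $\alpha,\beta$ on $\mathbb{R}^d$ let $$\mathcal{W}_2(\alpha,\beta)=\Big(\inf_{\pi}\int \lVert x-y\rVert^2\,\pi(\mathrm{d}x,\mathrm{d}y)\Big)^{1/2},$$ the infimum being over all couplings $\pi$ of $\alpha$ and $\beta$, i.e. probability measures on $\mathbb{R}^d\times\mathbb{R}^d$ with marginals $\alpha$ and $\beta$. Let $X_1,\dots,X_n,Z_1,\dots,Z_n\sim\mu$ and $Y_1,\dots,Y_n\sim\nu$ be random variables that are all (jointly) independent, and let $$\hat\mu_n'=\frac1n\sum_{i=1}^n\delta_{X_i},\qquad \hat\nu_n=\frac1n\sum_{i=1}^n\delta_{Y_i},\qquad \hat\mu_n=\frac1n\sum_{i=1}^n\delta_{Z_i}.$$ Define the estimators $$U=\mathcal{W}_2^2(\hat\nu_n,\hat\mu_n)-\mathcal{W}_2^2(\hat\mu_n',\hat\mu_n),\qquad L=\mathcal{W}_2(\hat\nu_n,\hat\mu_n)-\mathcal{W}_2(\hat\mu_n',\hat\mu_n).$$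 Then $U$ and $L$ are integrable and, for all $t\ge 0$, $$\mathbb{P}\big(|U-\mathbb{E}U|\ge t\big)\le 4\exp\big(-nt^2/4\big),\qquad \mathbb{P}\big(|L-\mathbb{E}L|\ge t\big)\le 4\exp\big(-nt^4/256\big).$$ -/

import Mathlib

open MeasureTheory ProbabilityTheory
open scoped ENNReal

noncomputable section

/-- The couplings of two Borel measures `μ`, `ν` on `ℝ^d`: the measures on the product whose
first and second marginals are `μ` and `ν`. -/
def couplings {d : ℕ} (μ ν : Measure (EuclideanSpace ℝ (Fin d))) :
    Set (Measure (EuclideanSpace ℝ (Fin d) × EuclideanSpace ℝ (Fin d))) :=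
  {π | π.map Prod.fst = μ ∧ π.map Prod.snd = ν}

/-- The Wasserstein distance of order `2` on `ℝ^d` (Euclidean norm), with values in `[0, ∞]`. -/
def W₂ {d : ℕ} (μ ν : Measure (EuclideanSpace ℝ (Fin d))) : ℝ≥0∞ :=
  (⨅ π ∈ couplings μ ν, ∫⁻ p, ‖p.1 - p.2‖ₑ ^ 2 ∂π) ^ (1 / 2 : ℝ)

/-- The empirical measure `(1 / n) ∑ i, δ_{x i}` of `n` points. -/
def empiricalMeasure {d n : ℕ} (x : Fin n → EuclideanSpace ℝ (Fin d)) :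
    Measure (EuclideanSpace ℝ (Fin d)) :=
  (n : ℝ≥0∞)⁻¹ • ∑ i, Measure.dirac (x i)

/-- `U(ν̂, μ̂, μ̂') = W₂²(ν̂, μ̂) - W₂²(μ̂', μ̂)`. -/
def upperEstimator {d : ℕ} (νh μh μh' : Measure (EuclideanSpace ℝ (Fin d))) : ℝ :=
  (W₂ νh μh).toReal ^ 2 - (W₂ μh' μh).toReal ^ 2

/-- `L(ν̂, μ̂, μ̂') = W₂(ν̂, μ̂) - W₂(μ̂', μ̂)`. -/
def lowerEstimator {d : ℕ} (νh μh μh' : Measure (EuclideanSpace ℝ (Fin d))) : ℝ :=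
  (W₂ νh μh).toReal - (W₂ μh' μh).toReal

end

/-! Transport between two `n`-point empirical measures is a linear program over matrices with row
and column sums `1 / n` (`iInf_couplings_empiricalMeasure`). Moving one sample point affects a
single row or column, so with costs at most `1` the squared distance changes by at most `1 / n`.
McDiarmid's inequality over the `2n` independent points then makes each centred `W₂²` sub-Gaussian
with parameter `2n * (1 / (2n))^2 = 1 / (2n)`.

The two terms of `U` share the sample `Z` and so are dependent: each is bounded at level `t / 2` and
the tails are added.

For `L`, let `A` be one of the distances and `M = E[A²]`. Since `|A - √M|² ≤ |A² - M|`, a deviation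
of `A` from `√M` forces one of `A²`. Jensen's inequality for the fourth power and the variance bound
for `A²` place `E[A]` within `t / 4` of `√M` when `n * t^4 > 256`; otherwise the claimed bound
exceeds `1`. -/

/-- A bounded measurable function on a probability space is integrable. -/
lemma integrable_of_forall_abs_le {α : Type*} [MeasurableSpace α] (μ : Measure α)
    [IsFiniteMeasure μ] {f : α → ℝ} (hf : Measurable f) {M : ℝ} (hM : ∀ x, |f x| ≤ M) :
    Integrable f μ :=
  Integrable.of_bound hf.aestronglyMeasurable M (ae_of_all _ fun x => by simpa using hM x)

/-! ### McDiarmid's inequality. -/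

/-- **McDiarmid's inequality** in its moment generating function form: a bounded measurable
function of independent coordinates which has bounded differences is sub-Gaussian. -/
theorem hasSubgaussianMGF_pi_of_bounded_differences {E : Type*} [MeasurableSpace E] {m : ℕ}
    (μ : Fin m → Measure E) [∀ i, IsProbabilityMeasure (μ i)] (c : Fin m → NNReal)
    {f : (Fin m → E) → ℝ} (hf : Measurable f) {M : ℝ} (hM : ∀ x, |f x| ≤ M)
    (hc : ∀ x i y, f (Function.update x i y) ≤ f x + c i) :
    HasSubgaussianMGF (fun x => f x - ∫ y, f y ∂Measure.pi μ) (∑ i, (c i / 2) ^ 2)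
      (Measure.pi μ) := by
  have hint : ∀ {m : ℕ} (μ : Fin m → Measure E) [∀ i, IsProbabilityMeasure (μ i)]
      {f : (Fin m → E) → ℝ} (_ : Measurable f) {M : ℝ} (_ : ∀ x, |f x| ≤ M) (k t : ℝ),
      Integrable (fun x => Real.exp (t * (f x - k))) (Measure.pi μ) := by
    intro m μ _ f hf M hM k t
    refine integrable_of_forall_abs_le _ (by fun_prop) (M := Real.exp (|t| * (M + |k|)))
      fun x => ?_
    rw [Real.abs_exp]
    refine Real.exp_le_exp.2 ((le_abs_self _).trans ?_)
    rw [abs_mul]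
    gcongr
    exact (abs_sub _ _).trans (by gcongr; exact hM x)
  refine ⟨hint μ hf hM _, ?_⟩
  induction m generalizing M with
  | zero =>
    intro t
    have h1 : ∀ x : Fin 0 → E, f x = f default := fun x => congrArg f (Subsingleton.elim _ _)
    simp [mgf, h1]
  | succ m ih =>
    intro t
    set ρ : Measure (Fin m → E) := Measure.pi fun j => μ (Fin.succ j) with hρ
    have hmp := (measurePreserving_piFinSuccAbove μ 0).symm
    have hmp' : MeasurePreserving (fun p : E × (Fin m → E) => (Fin.cons p.1 p.2 : Fin (m + 1) → E))
        ((μ 0).prod ρ) (Measure.pi μ) := by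
      convert hmp using 1
      · ext p : 1
        simp [MeasurableEquiv.piFinSuccAbove_symm_apply, Fin.insertNthEquiv]
      · simp [hρ]
    have hcons : Measurable fun p : E × (Fin m → E) => (Fin.cons p.1 p.2 : Fin (m + 1) → E) :=
      hmp'.measurable
    have hfc : Measurable fun p : E × (Fin m → E) => f (Fin.cons p.1 p.2) := hf.comp hcons
    set g : (Fin m → E) → ℝ := fun x => ∫ a, f (Fin.cons a x) ∂μ 0 with hg
    have hfx : ∀ x, Measurable fun a => f (Fin.cons a x) := fun x =>
      hfc.comp (measurable_id.prodMk measurable_const)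
    have hfi : ∀ x, Integrable (fun a => f (Fin.cons a x)) (μ 0) := fun x =>
      integrable_of_forall_abs_le _ (hfx x) fun a => hM _
    have hgm : Measurable g :=
      (StronglyMeasurable.integral_prod_left' (μ := μ 0) hfc.stronglyMeasurable).measurable
    have hgM : ∀ x, |g x| ≤ M := fun x => by
      have := norm_integral_le_of_norm_le_const (μ := μ 0) (f := fun a => f (Fin.cons a x))
        (C := M) (ae_of_all _ fun a => by simpa using hM _)
      simpa using this
    have hgc : ∀ x i y, g (Function.update x i y) ≤ g x + c (Fin.succ i) := by
      intro x i y
      have h1 : g x + c (Fin.succ i) = ∫ a, (f (Fin.cons a x) + c (Fin.succ i)) ∂μ 0 := by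
        rw [integral_add (hfi x) (integrable_const _)]; simp [hg]
      rw [h1]
      refine integral_mono (hfi _) ((hfi x).add (integrable_const _)) fun a => ?_
      have := hc (Fin.cons a x) i.succ y
      rwa [← Fin.cons_update] at this
    have hswap : ∀ {F : (Fin (m + 1) → E) → ℝ}, Measurable F → Integrable F (Measure.pi μ) →
        ∫ y, F y ∂Measure.pi μ = ∫ x, ∫ a, F (Fin.cons a x) ∂μ 0 ∂ρ := by
      intro F hF hFi
      rw [← hmp'.map_eq, integral_map hcons.aemeasurable hF.aestronglyMeasurable]
      refine integral_prod_symm _ ?_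
      exact (hmp'.integrable_comp hF.aestronglyMeasurable).2 hFi
    have hmean : ∫ y, f y ∂Measure.pi μ = ∫ x, g x ∂ρ :=
      hswap hf (integrable_of_forall_abs_le _ hf hM)
    have hIH := ih (fun j => μ (Fin.succ j)) (fun j => c (Fin.succ j)) hgm hgM hgc t
    -- Hoeffding's lemma in the first coordinate: with the others frozen, `f` takes values in an
    -- interval of length `c 0` above its infimum, and its mean is `g x`.
    have hoeff : ∀ x, ∫ a, Real.exp (t * (f (Fin.cons a x) - g x)) ∂μ 0
        ≤ Real.exp ((c 0 / 2) ^ 2 * t ^ 2 / 2) := by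
      intro x
      have hbdd : BddBelow (Set.range fun a => f (Fin.cons a x)) :=
        ⟨-M, by rintro _ ⟨a, rfl⟩; exact (abs_le.1 (hM _)).1⟩
      have hne : Nonempty E := (μ 0).nonempty_of_neZero
      have hmem : ∀ a, f (Fin.cons a x) ∈ Set.Icc (⨅ b, f (Fin.cons b x))
          ((⨅ b, f (Fin.cons b x)) + c 0) := by
        intro a
        refine ⟨ciInf_le hbdd a, ?_⟩
        rw [← sub_le_iff_le_add]
        refine le_ciInf fun b => ?_
        have := hc (Fin.cons b x) 0 a
        rw [Fin.update_cons_zero] at this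
        linarith
      have := (hasSubgaussianMGF_of_mem_Icc (μ := μ 0) (hfx x).aemeasurable
        (ae_of_all _ hmem)).mgf_le t
      simpa [mgf] using this
    have hexpm : Measurable fun y => Real.exp (t * (f y - ∫ x, g x ∂ρ)) := by fun_prop
    rw [hmean]
    unfold mgf at hIH ⊢
    rw [hswap hexpm (hint μ hf hM _ t)]
    have hsplit : ∀ x, ∫ a, Real.exp (t * (f (Fin.cons a x) - ∫ x, g x ∂ρ)) ∂μ 0
        ≤ Real.exp ((c 0 / 2) ^ 2 * t ^ 2 / 2) * Real.exp (t * (g x - ∫ x, g x ∂ρ)) := by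
      intro x
      have : ∀ a, Real.exp (t * (f (Fin.cons a x) - ∫ x, g x ∂ρ))
          = Real.exp (t * (f (Fin.cons a x) - g x)) * Real.exp (t * (g x - ∫ x, g x ∂ρ)) := by
        intro a; rw [← Real.exp_add]; ring_nf
      simp_rw [this]
      rw [integral_mul_const]
      gcongr
      exact hoeff x
    calc ∫ x, ∫ a, Real.exp (t * (f (Fin.cons a x) - ∫ x, g x ∂ρ)) ∂μ 0 ∂ρ
        ≤ ∫ x, Real.exp ((c 0 / 2) ^ 2 * t ^ 2 / 2) * Real.exp (t * (g x - ∫ x, g x ∂ρ)) ∂ρ := by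
          refine integral_mono_of_nonneg (ae_of_all _ fun x => integral_nonneg fun a =>
            (Real.exp_pos _).le) ((hint _ hgm hgM _ t).const_mul _) (ae_of_all _ hsplit)
      _ ≤ Real.exp ((c 0 / 2) ^ 2 * t ^ 2 / 2) *
          Real.exp ((∑ i : Fin m, (c i.succ / 2) ^ 2 : NNReal) * t ^ 2 / 2) := by
          rw [integral_const_mul]
          gcongr
      _ = Real.exp ((∑ i, (c i / 2) ^ 2 : NNReal) * t ^ 2 / 2) := by
          rw [← Real.exp_add, Fin.sum_univ_succ]
          push_cast
          ring_nf

/-- **McDiarmid's inequality** for a finite family of independent random variables. -/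
theorem hasSubgaussianMGF_of_iIndepFun_of_bounded_differences {Ω E ι : Type*} [MeasurableSpace Ω]
    {P : Measure Ω} [IsProbabilityMeasure P] [MeasurableSpace E] [Fintype ι] [DecidableEq ι]
    {X : ι → Ω → E} (hX : ∀ i, AEMeasurable (X i) P) (hind : iIndepFun X P) (c : NNReal)
    {f : (ι → E) → ℝ} (hf : Measurable f) {M : ℝ} (hM : ∀ x, |f x| ≤ M)
    (hc : ∀ x i y, f (Function.update x i y) ≤ f x + c) :
    HasSubgaussianMGF (fun ω => f (fun i => X i ω) - ∫ ω', f (fun i => X i ω') ∂P)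
      (Fintype.card ι * (c / 2) ^ 2) P := by
  classical
  set e : Fin (Fintype.card ι) ≃ ι := (Fintype.equivFin ι).symm
  have hind' : iIndepFun (fun k => X (e k)) P := hind.precomp e.injective
  have hmap := (iIndepFun_iff_map_fun_eq_pi_map (fun k => hX (e k))).1 hind'
  have hprob : ∀ k, IsProbabilityMeasure (P.map (X (e k))) := fun k =>
    Measure.isProbabilityMeasure_map (hX _)
  have hXe : AEMeasurable (fun ω k => X (e k) ω) P := aemeasurable_pi_lambda _ fun k => hX (e k)
  set f' : (Fin (Fintype.card ι) → E) → ℝ := fun x => f fun i => x (e.symm i) with hf'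
  have hf'm : Measurable f' := hf.comp (measurable_pi_lambda _ fun i => measurable_pi_apply _)
  have key := hasSubgaussianMGF_pi_of_bounded_differences (fun k => P.map (X (e k)))
    (fun _ => c) hf'm (fun x => hM _) (by
      intro x k y
      have := hc (fun i => x (e.symm i)) (e k) y
      convert this using 2
      ext i
      by_cases h : i = e k
      · subst h; simp
      · have : e.symm i ≠ k := fun h' => h (by simp [← h'])
        simp [h, this])
  rw [← hmap] at key
  have := HasSubgaussianMGF.of_map hXe key
  rw [integral_map hXe hf'm.aestronglyMeasurable] at this
  simpa [Function.comp_def, hf', mul_comm] using this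

/-! ### The discrete transport problem. -/

/-- The `n × n` matrices with nonnegative entries and all row and column sums equal to `1 / n`. -/
def transportPlans (n : ℕ) : Set (Fin n → Fin n → ℝ≥0∞) :=
  {a | (∀ i, ∑ j, a i j = (n : ℝ≥0∞)⁻¹) ∧ ∀ j, ∑ i, a i j = (n : ℝ≥0∞)⁻¹}

/-- The optimal cost of transporting the uniform measure on the points `x i` to the uniform
measure on the points `z j`, for the cost function `k`. -/
noncomputable def discreteCost {E : Type*} {n : ℕ} (k : E → E → ℝ≥0∞) (x z : Fin n → E) : ℝ≥0∞ :=
  ⨅ a ∈ transportPlans n, ∑ i, ∑ j, a i j * k (x i) (z j)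

section DiscreteCost

variable {E : Type*} {n : ℕ} {k : E → E → ℝ≥0∞}

lemma transportPlans.ne_top {a : Fin n → Fin n → ℝ≥0∞} (ha : a ∈ transportPlans n)
    (i j : Fin n) : a i j ≠ ∞ := by
  refine ne_top_of_le_ne_top ?_
    ((Finset.single_le_sum (fun _ _ => zero_le) (Finset.mem_univ j)).trans_eq (ha.1 i))
  have : n ≠ 0 := by have := i.pos; omega
  simpa using this

lemma uniform_mem_transportPlans (hn : n ≠ 0) :
    (fun _ _ => (n : ℝ≥0∞)⁻¹ * (n : ℝ≥0∞)⁻¹) ∈ transportPlans n := by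
  have h : (n : ℝ≥0∞) * ((n : ℝ≥0∞)⁻¹ * (n : ℝ≥0∞)⁻¹) = (n : ℝ≥0∞)⁻¹ := by
    rw [← mul_assoc, ENNReal.mul_inv_cancel (by simpa using hn) (by simp), one_mul]
  exact ⟨fun i => by simpa using h, fun j => by simpa using h⟩

lemma discreteCost_le_one (hn : n ≠ 0) (hk : ∀ u v, k u v ≤ 1) (x z : Fin n → E) :
    discreteCost k x z ≤ 1 := by
  refine (iInf₂_le _ (uniform_mem_transportPlans hn)).trans ?_
  calc ∑ i, ∑ j, (n : ℝ≥0∞)⁻¹ * (n : ℝ≥0∞)⁻¹ * k (x i) (z j)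
      ≤ ∑ i : Fin n, ∑ j : Fin n, (n : ℝ≥0∞)⁻¹ * (n : ℝ≥0∞)⁻¹ := by
        exact Finset.sum_le_sum fun i _ => Finset.sum_le_sum fun j _ =>
          mul_le_of_le_one_right' (hk _ _)
    _ = ∑ i : Fin n, (n : ℝ≥0∞)⁻¹ :=
        Finset.sum_congr rfl fun i _ => (uniform_mem_transportPlans hn).1 i
    _ = 1 := by simpa using ENNReal.mul_inv_cancel (by simpa using hn) (by simp)

lemma discreteCost_congr {k' : E → E → ℝ≥0∞} {x z : Fin n → E}
    (h : ∀ i j, k (x i) (z j) = k' (x i) (z j)) : discreteCost k x z = discreteCost k' x z := by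
  simp only [discreteCost, h]

lemma discreteCost_swap (k : E → E → ℝ≥0∞) (x z : Fin n → E) :
    discreteCost k x z = discreteCost (fun u v => k v u) z x := by
  have : ∀ (k : E → E → ℝ≥0∞) (x z : Fin n → E),
      discreteCost (fun u v => k v u) z x ≤ discreteCost k x z := by
    intro k x z
    refine le_iInf₂ fun a ha => ?_
    refine (iInf₂_le (fun i j => a j i) ⟨ha.2, ha.1⟩).trans_eq ?_
    exact Finset.sum_comm
  exact le_antisymm (this _ _ _) (this _ _ _)

/-- Any plan stays admissible after the update. Only row `i` changes cost; it carries mass `1 / n`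
at unit cost at most `1`. -/
lemma discreteCost_update_left_le (hk : ∀ u v, k u v ≤ 1) (x z : Fin n → E) (i : Fin n) (y : E) :
    discreteCost k (Function.update x i y) z ≤ discreteCost k x z + (n : ℝ≥0∞)⁻¹ := by
  rw [discreteCost, discreteCost, ENNReal.iInf₂_add]
  refine iInf₂_mono fun a ha => ?_
  calc ∑ l, ∑ j, a l j * k (Function.update x i y l) (z j)
      ≤ ∑ l, (∑ j, a l j * k (x l) (z j) + if l = i then (n : ℝ≥0∞)⁻¹ else 0) := by
        refine Finset.sum_le_sum fun l _ => ?_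
        by_cases h : l = i
        · rw [if_pos h, ← ha.1 l]
          refine le_add_left (Finset.sum_le_sum fun j _ => mul_le_of_le_one_right' (hk _ _))
        · simp [h]
    _ = _ := by rw [Finset.sum_add_distrib]; simp

lemma discreteCost_update_right_le (hk : ∀ u v, k u v ≤ 1) (x z : Fin n → E) (i : Fin n) (y : E) :
    discreteCost k x (Function.update z i y) ≤ discreteCost k x z + (n : ℝ≥0∞)⁻¹ := by
  rw [discreteCost_swap, discreteCost_swap k]
  exact discreteCost_update_left_le (fun u v => hk v u) _ _ _ _

/-- Serves to obtain measurability: the infimum runs over uncountably many plans, but an infimum of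
continuous functions is upper semicontinuous. -/
lemma upperSemicontinuous_discreteCost [TopologicalSpace E]
    (hk : Continuous fun p : E × E => k p.1 p.2) :
    UpperSemicontinuous fun w : Fin n ⊕ Fin n → E =>
      discreteCost k (fun i => w (.inl i)) (fun j => w (.inr j)) := by
  refine upperSemicontinuous_biInf fun a ha => Continuous.upperSemicontinuous ?_
  refine continuous_finsetSum _ fun i _ => continuous_finsetSum _ fun j _ => ?_
  have hij : Continuous fun w : Fin n ⊕ Fin n → E => (w (.inl i), w (.inr j)) := by fun_prop
  exact (ENNReal.continuous_const_mul (transportPlans.ne_top ha i j)).comp (hk.comp hij)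

end DiscreteCost

/-! ### Transport between empirical measures. -/

section Empirical

variable {d n : ℕ}

local notation "𝔼" => EuclideanSpace ℝ (Fin d)

open Classical in
/-- The function which is `1 / #{l | x l = x i}` at `x i` and vanishes elsewhere. -/
noncomputable def pointWeight {E : Type*} (x : Fin n → E) (i : Fin n) (y : E) : ℝ≥0∞ :=
  if y = x i then ((Finset.univ.filter fun l => x l = x i).card : ℝ≥0∞)⁻¹ else 0

lemma card_mul_inv_card_fiber [DecidableEq (EuclideanSpace ℝ (Fin d))] (x : Fin n → 𝔼)
    (i : Fin n) : ((Finset.univ.filter fun l => x l = x i).card : ℝ≥0∞) *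
      ((Finset.univ.filter fun l => x l = x i).card : ℝ≥0∞)⁻¹ = 1 := by
  refine ENNReal.mul_inv_cancel ?_ (by simp)
  simp

/-- Sample points may coincide; the weights share the mass of a repeated point equally among its
indices and form a partition of unity on the sample. -/
lemma sum_pointWeight (x : Fin n → 𝔼) (m : Fin n) : ∑ i, pointWeight x i (x m) = 1 := by
  classical
  have : ∀ i, pointWeight x i (x m) =
      if x i = x m then ((Finset.univ.filter fun l => x l = x m).card : ℝ≥0∞)⁻¹ else 0 := by
    intro i
    unfold pointWeight
    by_cases h : x i = x m
    · simp [h]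
    · simp [h, Ne.symm h]
  simp_rw [this, ← Finset.sum_filter, Finset.sum_const, nsmul_eq_mul]
  exact card_mul_inv_card_fiber x m

lemma measurable_pointWeight (x : Fin n → 𝔼) (i : Fin n) : Measurable (pointWeight x i) :=
  Measurable.ite (measurableSet_singleton (x i)) measurable_const measurable_const

lemma lintegral_empiricalMeasure (x : Fin n → 𝔼) (f : 𝔼 → ℝ≥0∞) :
    ∫⁻ y, f y ∂empiricalMeasure x = (n : ℝ≥0∞)⁻¹ * ∑ i, f (x i) := by
  rw [empiricalMeasure, lintegral_smul_measure, lintegral_finsetSum_measure]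
  simp

lemma lintegral_pointWeight (x : Fin n → 𝔼) (i : Fin n) :
    ∫⁻ y, pointWeight x i y ∂empiricalMeasure x = (n : ℝ≥0∞)⁻¹ := by
  classical
  rw [lintegral_empiricalMeasure]
  have : ∀ l, pointWeight x i (x l) =
      if x l = x i then ((Finset.univ.filter fun l => x l = x i).card : ℝ≥0∞)⁻¹ else 0 := by
    intro l
    unfold pointWeight
    by_cases h : x l = x i
    · simp only [h, if_true]
      congr
    · simp [h]
  simp_rw [this, ← Finset.sum_filter, Finset.sum_const, nsmul_eq_mul]
  rw [card_mul_inv_card_fiber x i, mul_one]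

lemma ae_mem_range_empiricalMeasure (x : Fin n → 𝔼) :
    ∀ᵐ y ∂empiricalMeasure x, y ∈ Set.range x := by
  have hm : MeasurableSet (Set.range x)ᶜ := (Set.finite_range x).measurableSet.compl
  rw [ae_iff]
  change empiricalMeasure x (Set.range x)ᶜ = 0
  simp [empiricalMeasure, Measure.smul_apply, Measure.finsetSum_apply, Measure.dirac_apply' _ hm]

/-- The optimal transport problem between two empirical measures is a problem over matrices. -/
theorem iInf_couplings_empiricalMeasure (k : 𝔼 → 𝔼 → ℝ≥0∞) (x z : Fin n → 𝔼) :
    ⨅ π ∈ couplings (empiricalMeasure x) (empiricalMeasure z), ∫⁻ p, k p.1 p.2 ∂π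
      = discreteCost k x z := by
  apply le_antisymm
  · refine le_iInf₂ fun a ha => ?_
    suffices hmem : ∑ i, ∑ j, a i j • Measure.dirac (x i, z j) ∈
        couplings (empiricalMeasure x) (empiricalMeasure z) by
      refine (iInf₂_le _ hmem).trans_eq ?_
      simp [lintegral_finsetSum_measure, lintegral_smul_measure]
    constructor
    · refine Measure.ext fun s hs => ?_
      rw [Measure.map_apply measurable_fst hs]
      have hs' : MeasurableSet (Prod.fst ⁻¹' s : Set (𝔼 × 𝔼)) := measurable_fst hs
      simp only [empiricalMeasure, Measure.finsetSum_apply, Measure.smul_apply, smul_eq_mul,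
        Measure.dirac_apply' _ hs, Measure.dirac_apply' _ hs', Finset.mul_sum]
      refine Finset.sum_congr rfl fun i _ => ?_
      rw [← ha.1 i, Finset.sum_mul]
      rfl
    · refine Measure.ext fun s hs => ?_
      rw [Measure.map_apply measurable_snd hs]
      have hs' : MeasurableSet (Prod.snd ⁻¹' s : Set (𝔼 × 𝔼)) := measurable_snd hs
      simp only [empiricalMeasure, Measure.finsetSum_apply, Measure.smul_apply, smul_eq_mul,
        Measure.dirac_apply' _ hs, Measure.dirac_apply' _ hs', Finset.mul_sum]
      rw [Finset.sum_comm]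
      refine Finset.sum_congr rfl fun j _ => ?_
      rw [← ha.2 j, Finset.sum_mul]
      rfl
  · refine le_iInf₂ fun π hπ => ?_
    have hgh : ∀ i j, Measurable fun p : 𝔼 × 𝔼 => pointWeight x i p.1 * pointWeight z j p.2 :=
      fun i j => ((measurable_pointWeight x i).comp measurable_fst).mul
        ((measurable_pointWeight z j).comp measurable_snd)
    have hx : ∀ᵐ p ∂π, p.1 ∈ Set.range x :=
      ae_of_ae_map measurable_fst.aemeasurable (hπ.1 ▸ ae_mem_range_empiricalMeasure x)
    have hz : ∀ᵐ p ∂π, p.2 ∈ Set.range z :=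
      ae_of_ae_map measurable_snd.aemeasurable (hπ.2 ▸ ae_mem_range_empiricalMeasure z)
    -- Integrating the product weights against `π` turns it into a matrix: summing out one index
    -- removes that weight almost everywhere, leaving the integral of the other, which is `1 / n`.
    have hmem : (fun i j => ∫⁻ p, pointWeight x i p.1 * pointWeight z j p.2 ∂π) ∈
        transportPlans n := by
      refine ⟨fun i => ?_, fun j => ?_⟩
      · rw [← lintegral_finsetSum _ fun j _ => hgh i j, ← lintegral_pointWeight x i, ← hπ.1,
          lintegral_map (measurable_pointWeight x i) measurable_fst]
        refine lintegral_congr_ae ?_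
        filter_upwards [hz] with p ⟨m, hm⟩
        rw [← Finset.mul_sum, ← hm, sum_pointWeight, mul_one]
      · rw [← lintegral_finsetSum _ fun i _ => hgh i j, ← lintegral_pointWeight z j, ← hπ.2,
          lintegral_map (measurable_pointWeight z j) measurable_snd]
        refine lintegral_congr_ae ?_
        filter_upwards [hx] with p ⟨m, hm⟩
        rw [← Finset.sum_mul, ← hm, sum_pointWeight, one_mul]
    refine (iInf₂_le _ hmem).trans_eq ?_
    have hsum : ∑ i, ∑ j, (∫⁻ p, pointWeight x i p.1 * pointWeight z j p.2 ∂π) * k (x i) (z j)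
        = ∫⁻ p, ∑ i, ∑ j, pointWeight x i p.1 * pointWeight z j p.2 * k (x i) (z j) ∂π := by
      rw [lintegral_finsetSum _ fun i _ => Finset.measurable_fun_sum _ fun j _ =>
        (hgh i j).mul_const (k (x i) (z j))]
      refine Finset.sum_congr rfl fun i _ => ?_
      rw [lintegral_finsetSum _ fun j _ => (hgh i j).mul_const (k (x i) (z j))]
      exact Finset.sum_congr rfl fun j _ => (lintegral_mul_const _ (hgh i j)).symm
    rw [hsum]
    refine lintegral_congr_ae ?_
    filter_upwards [hx, hz] with p ⟨m, hm⟩ ⟨l, hl⟩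
    have : ∀ i j, pointWeight x i p.1 * pointWeight z j p.2 * k (x i) (z j)
        = pointWeight x i (x m) * (pointWeight z j (z l) * k p.1 p.2) := by
      intro i j
      rw [← hm, ← hl]
      by_cases h1 : x m = x i
      · by_cases h2 : z l = z j
        · rw [h1, h2, mul_assoc]
        · simp [pointWeight, h2]
      · simp [pointWeight, h1]
    simp_rw [this, ← Finset.mul_sum, ← Finset.sum_mul, sum_pointWeight, one_mul]

/-- The optimal transport cost between the uniform measures on the two halves of `w`, for the
squared distance truncated at `1`. -/
noncomputable def truncatedCost (w : Fin n ⊕ Fin n → 𝔼) : ℝ :=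
  (discreteCost (fun u v : 𝔼 => min (‖u - v‖ₑ ^ 2) 1) (fun i => w (.inl i))
    (fun j => w (.inr j))).toReal

lemma measurable_truncatedCost : Measurable (truncatedCost (d := d) (n := n)) := by
  refine ENNReal.measurable_toReal.comp (upperSemicontinuous_discreteCost ?_).measurable
  fun_prop

lemma truncatedCost_nonneg (w : Fin n ⊕ Fin n → 𝔼) : 0 ≤ truncatedCost w :=
  ENNReal.toReal_nonneg

lemma abs_truncatedCost_le_one (hn : n ≠ 0) (w : Fin n ⊕ Fin n → 𝔼) : |truncatedCost w| ≤ 1 := by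
  rw [abs_of_nonneg (truncatedCost_nonneg w)]
  exact ENNReal.toReal_le_of_le_ofReal zero_le_one
    (by simpa using discreteCost_le_one hn (fun _ _ => min_le_right _ _) _ _)

/-- The truncation is what allows an arbitrary `y`, as McDiarmid's inequality requires, rather than
only points of the bounded support. -/
lemma truncatedCost_update_le (hn : n ≠ 0) (w : Fin n ⊕ Fin n → 𝔼) (i : Fin n ⊕ Fin n) (y : 𝔼) :
    truncatedCost (Function.update w i y) ≤ truncatedCost w + ((n : NNReal)⁻¹ : NNReal) := by
  have hk : ∀ u v : 𝔼, min (‖u - v‖ₑ ^ 2) 1 ≤ 1 := fun _ _ => min_le_right _ _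
  have hfin : ∀ x z : Fin n → 𝔼, discreteCost (fun u v : 𝔼 => min (‖u - v‖ₑ ^ 2) 1) x z ≠ ∞ :=
    fun x z => ne_top_of_le_ne_top ENNReal.one_ne_top (discreteCost_le_one hn hk x z)
  have hinv : ((n : ℝ≥0∞)⁻¹) ≠ ∞ := by simpa using hn
  have hinv' : (((n : NNReal)⁻¹ : NNReal) : ℝ) = ((n : ℝ≥0∞)⁻¹).toReal := by simp
  rw [hinv', truncatedCost, truncatedCost, ← ENNReal.toReal_add (hfin _ _) hinv]
  refine ENNReal.toReal_mono (ENNReal.add_ne_top.2 ⟨hfin _ _, hinv⟩) ?_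
  cases i with
  | inl i =>
    convert discreteCost_update_left_le hk (fun i => w (.inl i)) (fun j => w (.inr j)) i y using 2
    · ext l : 1
      simp [Function.update_apply]
    · simp
  | inr i =>
    convert discreteCost_update_right_le hk (fun i => w (.inl i)) (fun j => w (.inr j)) i y using 2
    · simp
    · ext l : 1
      simp [Function.update_apply]

/-- The Wasserstein distance of two empirical measures whose points are at distance at most `1`. -/
lemma toReal_W₂_empiricalMeasure_eq_sqrt (w : Fin n ⊕ Fin n → 𝔼)
    (hw : ∀ i j, ‖w (.inl i) - w (.inr j)‖ₑ ≤ 1) :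
    (W₂ (empiricalMeasure fun i => w (.inl i)) (empiricalMeasure fun j => w (.inr j))).toReal
      = √(truncatedCost w) := by
  rw [W₂, iInf_couplings_empiricalMeasure (fun u v : 𝔼 => ‖u - v‖ₑ ^ 2), ← ENNReal.toReal_rpow,
    Real.sqrt_eq_rpow, truncatedCost]
  congr 2
  exact discreteCost_congr fun i j => (min_eq_left (pow_le_one' (hw i j) 2)).symm

end Empirical

/-! ### From a sub-Gaussian square to tails of the variable. -/

section Concentration

variable {Ω : Type*} [MeasurableSpace Ω] {P : Measure Ω}

lemma ProbabilityTheory.HasSubgaussianMGF.measure_abs_ge_le {X : Ω → ℝ} {c : NNReal}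
    (h : HasSubgaussianMGF X c P)
    {s : ℝ} (hs : 0 ≤ s) : P.real {ω | s ≤ |X ω|} ≤ 2 * Real.exp (-s ^ 2 / (2 * c)) := by
  have h1 := h.measure_ge_le hs
  have h2 := h.neg.measure_ge_le hs
  have : {ω | s ≤ |X ω|} = {ω | s ≤ X ω} ∪ {ω | s ≤ (-X) ω} := by
    ext ω; simp [le_abs]
  rw [this]
  linarith [measureReal_union_le (μ := P) {ω | s ≤ X ω} {ω | s ≤ (-X) ω}]

variable [IsProbabilityMeasure P]

lemma one_add_sq_div_two_le_cosh (x : ℝ) : 1 + x ^ 2 / 2 ≤ Real.cosh x := by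
  wlog hx : 0 ≤ x
  · simpa using this (-x) (by linarith)
  have h1 : x / 2 ≤ Real.sinh (x / 2) := Real.self_le_sinh_iff.2 (by positivity)
  have h2 := Real.cosh_two_mul (x / 2)
  rw [mul_div_cancel₀ x two_ne_zero, Real.cosh_sq] at h2
  nlinarith

/-- Evaluating the moment generating function at `±1 / √c` gives `1 + E[X²] / (2c) ≤ E[cosh (X /
√c)] ≤ exp (1 / 2) ≤ 2`. -/
lemma ProbabilityTheory.HasSubgaussianMGF.integral_sq_le {X : Ω → ℝ} {c : NNReal} (hc : 0 < c)
    (h : HasSubgaussianMGF X c P) : ∫ ω, X ω ^ 2 ∂P ≤ 2 * c := by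
  have hc' : (0 : ℝ) < c := hc
  set l : ℝ := (√(c : ℝ))⁻¹ with hl
  have hl2 : c * l ^ 2 = 1 := by
    rw [hl, inv_pow, Real.sq_sqrt hc'.le]; field_simp
  have hX2 : Integrable (fun ω => X ω ^ 2) P := (h.memLp 2).integrable_sq
  have hp := h.integrable_exp_mul l
  have hm := h.integrable_exp_mul (-l)
  have hpt : ∀ ω, 1 + (l * X ω) ^ 2 / 2 ≤ (Real.exp (l * X ω) + Real.exp (-l * X ω)) / 2 := by
    intro ω
    have := one_add_sq_div_two_le_cosh (l * X ω)
    rwa [Real.cosh_eq, ← neg_mul] at this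
  have hint := integral_mono (μ := P) (f := fun ω => 1 + (l * X ω) ^ 2 / 2)
    (by simp_rw [mul_pow]; exact (integrable_const _).add ((hX2.const_mul _).div_const _))
    ((hp.add hm).div_const 2) hpt
  have hL : ∫ ω, (1 + (l * X ω) ^ 2 / 2) ∂P = 1 + l ^ 2 * (∫ ω, X ω ^ 2 ∂P) / 2 := by
    simp_rw [mul_pow]
    rw [integral_add (integrable_const _) ((hX2.const_mul _).div_const _), integral_div,
      integral_const_mul]
    simp
  have hR : ∫ ω, (Real.exp (l * X ω) + Real.exp (-l * X ω)) / 2 ∂P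
      = (mgf X P l + mgf X P (-l)) / 2 := by
    rw [integral_div, integral_add hp hm]; rfl
  have h1 := h.mgf_le l
  have h2 := h.mgf_le (-l)
  rw [neg_sq] at h2
  rw [hl2] at h1 h2
  have h3 : Real.exp (1 / 2) ≤ 2 := by
    have := Real.exp_bound_div_one_sub_of_interval (x := 1 / 2) (by norm_num) (by norm_num)
    norm_num at this ⊢
    exact this
  have hfin : l ^ 2 * (∫ ω, X ω ^ 2 ∂P) ≤ 2 := by
    have : 1 + l ^ 2 * (∫ ω, X ω ^ 2 ∂P) / 2 ≤ 2 := by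
      rw [← hL]
      refine hint.trans ?_
      simp only [Pi.add_apply]
      rw [hR]; linarith
    linarith
  calc ∫ ω, X ω ^ 2 ∂P = c * (l ^ 2 * ∫ ω, X ω ^ 2 ∂P) := by rw [← mul_assoc, hl2, one_mul]
    _ ≤ c * 2 := by gcongr
    _ = 2 * c := mul_comm _ _

lemma measure_abs_sub_sub_integral_ge_le {A B : Ω → ℝ} (hA : Integrable A P) (hB : Integrable B P)
    {t p : ℝ} (hpA : P.real {ω | t / 2 ≤ |A ω - ∫ ω', A ω' ∂P|} ≤ p)
    (hpB : P.real {ω | t / 2 ≤ |B ω - ∫ ω', B ω' ∂P|} ≤ p) :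
    P.real {ω | t ≤ |(A ω - B ω) - ∫ ω', (A ω' - B ω') ∂P|} ≤ 2 * p := by
  have hsub : {ω | t ≤ |(A ω - B ω) - ∫ ω', (A ω' - B ω') ∂P|} ⊆
      {ω | t / 2 ≤ |A ω - ∫ ω', A ω' ∂P|} ∪ {ω | t / 2 ≤ |B ω - ∫ ω', B ω' ∂P|} := by
    intro ω hω
    rw [Set.mem_ofPred_eq, integral_sub hA hB] at hω
    by_contra hcon
    simp only [Set.mem_union, Set.mem_ofPred_eq, not_or, not_le] at hcon
    have := abs_sub (A ω - ∫ ω', A ω' ∂P) (B ω - ∫ ω', B ω' ∂P)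
    rw [sub_sub_sub_comm] at this
    linarith [hcon.1, hcon.2]
  linarith [measureReal_mono (μ := P) hsub, measureReal_union_le (μ := P)
    {ω | t / 2 ≤ |A ω - ∫ ω', A ω' ∂P|} {ω | t / 2 ≤ |B ω - ∫ ω', B ω' ∂P|}]

/-- The mean of a nonnegative random variable is close to the square root of its second moment
when the square has small variance. -/
lemma pow_four_sqrt_integral_sq_sub_integral_le {A : Ω → ℝ} (hA0 : ∀ ω, 0 ≤ A ω)
    (hA : Integrable A P)
    (hD : MemLp (fun ω => A ω ^ 2 - ∫ ω', A ω' ^ 2 ∂P) 2 P) :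
    (∫ ω, A ω ∂P - √(∫ ω, A ω ^ 2 ∂P)) ^ 4
      ≤ ∫ ω, (A ω ^ 2 - ∫ ω', A ω' ^ 2 ∂P) ^ 2 ∂P := by
  set M := ∫ ω, A ω ^ 2 ∂P with hM
  have hM0 : 0 ≤ M := integral_nonneg fun ω => sq_nonneg _
  set e := ∫ ω, A ω ∂P - √M with he
  -- Jensen's inequality by hand: the integrand is the tangent to `u ^ 4` at `e`, taken at `u = A ω
  -- - √M`, whose mean is `e`.
  have hes : ∫ ω, (e ^ 4 + 4 * e ^ 3 * (A ω - √M - e)) ∂P = e ^ 4 := by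
    have h1 : Integrable (fun ω => A ω - √M - e) P :=
      (hA.sub (integrable_const _)).sub (integrable_const _)
    have h2 : ∫ ω, (A ω - √M - e) ∂P = 0 := by
      simp_rw [sub_sub]
      rw [integral_sub hA (integrable_const _)]
      simp [he]
    rw [integral_add (integrable_const _) (h1.const_mul _), integral_const_mul, h2]
    simp
  rw [← hes]
  refine integral_mono ((integrable_const _).add
    (((hA.sub (integrable_const _)).sub (integrable_const _)).const_mul _)) hD.integrable_sq
    fun ω => ?_
  have hs := Real.sq_sqrt hM0
  have hs0 := Real.sqrt_nonneg M
  have hA0' := hA0 ω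
  set s := √M
  -- With `u = A ω - s`, the difference of the two sides is `(u - e)^2 * ((u + e)^2 + 2 * e^2)`.
  have h1 : e ^ 4 + 4 * e ^ 3 * (A ω - s - e) ≤ (A ω - s) ^ 4 := by
    nlinarith [mul_nonneg (sq_nonneg (A ω - s - e)) (sq_nonneg (A ω - s + e)),
      mul_nonneg (sq_nonneg (A ω - s - e)) (sq_nonneg e)]
  have h2 : (A ω - s) ^ 4 ≤ (A ω ^ 2 - M) ^ 2 := by
    have h3 : (A ω - s) ^ 2 ≤ (A ω + s) ^ 2 := by nlinarith [mul_nonneg hA0' hs0]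
    have h4 : (A ω ^ 2 - M) ^ 2 = (A ω - s) ^ 2 * (A ω + s) ^ 2 := by rw [← hs]; ring
    rw [h4]
    calc (A ω - s) ^ 4 = (A ω - s) ^ 2 * (A ω - s) ^ 2 := by ring
      _ ≤ _ := by gcongr
  exact h1.trans h2

/-- Concentration of a nonnegative random variable whose square is sub-Gaussian. -/
lemma measure_abs_sub_integral_ge_le_of_hasSubgaussianMGF_sq {A : Ω → ℝ} (hA0 : ∀ ω, 0 ≤ A ω)
    (hA : Integrable A P) {c : NNReal} (hc : 0 < c)
    (h : HasSubgaussianMGF (fun ω => A ω ^ 2 - ∫ ω', A ω' ^ 2 ∂P) c P) {t : ℝ} (ht : 0 ≤ t)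
    (hbig : 512 * c < t ^ 4) :
    P.real {ω | t / 2 ≤ |A ω - ∫ ω', A ω' ∂P|} ≤ 2 * Real.exp (-t ^ 4 / (512 * c)) := by
  have hvar := (pow_four_sqrt_integral_sq_sub_integral_le hA0 hA (h.memLp 2)).trans
    (HasSubgaussianMGF.integral_sq_le hc h)
  set M := ∫ ω, A ω ^ 2 ∂P with hM
  have hM0 : 0 ≤ M := integral_nonneg fun ω => sq_nonneg _
  -- The fourth power of the left side is at most `2 * c`, and `hbig` says exactly that `2 * c < (t
  -- / 4)^4`.
  have hclose : |∫ ω, A ω ∂P - √M| < t / 4 := by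
    refine lt_of_pow_lt_pow_left₀ 4 (by positivity) ?_
    rw [Even.pow_abs (by decide)]
    calc _ ≤ 2 * (c : ℝ) := hvar
      _ < (t / 4) ^ 4 := by rw [div_pow]; linarith
  have hsub : {ω | t / 2 ≤ |A ω - ∫ ω', A ω' ∂P|} ⊆ {ω | t ^ 2 / 16 ≤ |A ω ^ 2 - M|} := by
    intro ω hω
    rw [Set.mem_ofPred_eq] at hω ⊢
    have h1 : t / 4 ≤ |A ω - √M| := by
      have := abs_sub_le (A ω) (√M) (∫ ω', A ω' ∂P)
      rw [abs_sub_comm (√M)] at this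
      linarith
    have h2 : |A ω - √M| ≤ A ω + √M := by
      rw [abs_le]; constructor <;> linarith [hA0 ω, Real.sqrt_nonneg M]
    have h3 : |A ω ^ 2 - M| = |A ω - √M| * (A ω + √M) := by
      rw [← abs_of_nonneg (add_nonneg (hA0 ω) (Real.sqrt_nonneg M)), ← abs_mul]
      congr 1
      nlinarith [Real.sq_sqrt hM0]
    rw [h3]
    nlinarith [abs_nonneg (A ω - √M)]
  refine (measureReal_mono hsub).trans
    ((HasSubgaussianMGF.measure_abs_ge_le h (by positivity)).trans_eq ?_)
  congr 2
  field_simp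
  ring

end Concentration

/-! ### Application to the estimators. -/

/-- The Wasserstein distance between the empirical measures of independent samples from a set of
diameter at most `1` is integrable, and its square is sub-Gaussian once centred. -/
lemma hasSubgaussianMGF_sq_W₂_empiricalMeasure {d n : ℕ} (hn : n ≠ 0)
    {S : Set (EuclideanSpace ℝ (Fin d))} (hS : Metric.ediam S ≤ 1)
    {Ω : Type*} [MeasurableSpace Ω] {P : Measure Ω} [IsProbabilityMeasure P]
    {W : Fin n ⊕ Fin n → Ω → EuclideanSpace ℝ (Fin d)} (hW : ∀ i, AEMeasurable (W i) P)
    (hWS : ∀ i, ∀ᵐ ω ∂P, W i ω ∈ S) (hind : iIndepFun W P) {A : Ω → ℝ}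
    (hA : A = fun ω => (W₂ (empiricalMeasure fun i => W (.inl i) ω)
      (empiricalMeasure fun i => W (.inr i) ω)).toReal) :
    Integrable A P ∧ HasSubgaussianMGF (fun ω => A ω ^ 2 - ∫ ω', A ω' ^ 2 ∂P)
      (2 * n : NNReal)⁻¹ P := by
  have hWm : AEMeasurable (fun ω i => W i ω) P := aemeasurable_pi_lambda _ hW
  -- Almost surely all points lie in `S`, where truncation is inactive; this also supplies the
  -- measurability of `A`.
  have hae : A =ᵐ[P] fun ω => √(truncatedCost fun i => W i ω) := by
    filter_upwards [ae_all_iff.2 hWS] with ω hω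
    rw [hA]
    refine toReal_W₂_empiricalMeasure_eq_sqrt (fun i => W i ω) fun i j => ?_
    rw [← edist_eq_enorm_sub]
    exact (Metric.edist_le_ediam_of_mem (hω _) (hω _)).trans hS
  have hae2 : (fun ω => A ω ^ 2) =ᵐ[P] fun ω => truncatedCost fun i => W i ω := by
    filter_upwards [hae] with ω hω
    rw [hω, Real.sq_sqrt (truncatedCost_nonneg _)]
  constructor
  · refine Integrable.congr ?_ hae.symm
    refine Integrable.of_bound ((measurable_truncatedCost.sqrt.comp_aemeasurable
      hWm).aestronglyMeasurable) 1 (ae_of_all _ fun ω => ?_)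
    rw [Real.norm_of_nonneg (Real.sqrt_nonneg _)]
    exact Real.sqrt_le_one.2 (abs_le.1 (abs_truncatedCost_le_one hn _)).2
  · have key := hasSubgaussianMGF_of_iIndepFun_of_bounded_differences hW hind (n : NNReal)⁻¹
      measurable_truncatedCost (abs_truncatedCost_le_one hn) (truncatedCost_update_le hn)
    have hc : (Fintype.card (Fin n ⊕ Fin n) : NNReal) * ((n : NNReal)⁻¹ / 2) ^ 2
        = (2 * n : NNReal)⁻¹ := by
      have : (n : NNReal) ≠ 0 := by exact_mod_cast hn
      simp
      field_simp
      norm_num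
    rw [hc, ← integral_congr_ae hae2] at key
    refine key.congr ?_
    filter_upwards [hae2] with ω hω
    rw [hω]

theorem theorem5 {d n : ℕ} (hn : 1 ≤ n)
    (μ ν : Measure (EuclideanSpace ℝ (Fin d))) [IsProbabilityMeasure μ] [IsProbabilityMeasure ν]
    (S : Set (EuclideanSpace ℝ (Fin d))) (hS : Metric.ediam S ≤ 1)
    (hμS : μ Sᶜ = 0) (hνS : ν Sᶜ = 0)
    {Ω : Type*} [MeasurableSpace Ω] (P : Measure Ω) [IsProbabilityMeasure P]
    (X Y Z : Fin n → Ω → EuclideanSpace ℝ (Fin d))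
    (hX : ∀ i, HasLaw (X i) μ P) (hY : ∀ i, HasLaw (Y i) ν P) (hZ : ∀ i, HasLaw (Z i) μ P)
    (hindep : iIndepFun (Sum.elim X (Sum.elim Y Z)) P)
    (U L : Ω → ℝ)
    (hU : U = fun ω => upperEstimator (empiricalMeasure (fun i => Y i ω))
      (empiricalMeasure (fun i => Z i ω)) (empiricalMeasure (fun i => X i ω)))
    (hL : L = fun ω => lowerEstimator (empiricalMeasure (fun i => Y i ω))
      (empiricalMeasure (fun i => Z i ω)) (empiricalMeasure (fun i => X i ω))) :
    Integrable U P ∧ Integrable L P ∧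
    ∀ t : ℝ, 0 ≤ t →
      P.real {ω | t ≤ |U ω - ∫ ω', U ω' ∂P|} ≤ 4 * Real.exp (-((n : ℝ) * t ^ 2 / 4)) ∧
      P.real {ω | t ≤ |L ω - ∫ ω', L ω' ∂P|} ≤ 4 * Real.exp (-((n : ℝ) * t ^ 4 / 256)) := by

  have hn0 : n ≠ 0 := by omega
  have hmemX : ∀ i, ∀ᵐ ω ∂P, X i ω ∈ S := fun i =>
    ae_of_ae_map (hX i).aemeasurable ((hX i).map_eq ▸ hμS)
  have hmemZ : ∀ i, ∀ᵐ ω ∂P, Z i ω ∈ S := fun i =>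
    ae_of_ae_map (hZ i).aemeasurable ((hZ i).map_eq ▸ hμS)
  have hmemY : ∀ i, ∀ᵐ ω ∂P, Y i ω ∈ S := fun i =>
    ae_of_ae_map (hY i).aemeasurable ((hY i).map_eq ▸ hνS)
  have hindYZ : iIndepFun (Sum.elim Y Z) P :=
    hindep.precomp (g := (Sum.inr : Fin n ⊕ Fin n → Fin n ⊕ (Fin n ⊕ Fin n))) Sum.inr_injective
  have hindXZ : iIndepFun (Sum.elim X Z) P := by
    have hinj : Function.Injective (Sum.map (id : Fin n → Fin n)
        (Sum.inr : Fin n → Fin n ⊕ Fin n)) :=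
      Function.injective_id.sumMap Sum.inr_injective
    have := hindep.precomp hinj
    convert this using 1
    ext i : 1
    cases i <;> rfl
  set A : Ω → ℝ := fun ω => (W₂ (empiricalMeasure fun i => Y i ω)
    (empiricalMeasure fun i => Z i ω)).toReal with hA
  set B : Ω → ℝ := fun ω => (W₂ (empiricalMeasure fun i => X i ω)
    (empiricalMeasure fun i => Z i ω)).toReal with hB
  obtain ⟨hAi, hAs⟩ := hasSubgaussianMGF_sq_W₂_empiricalMeasure (W := Sum.elim Y Z) hn0 hS
    (by rintro (i | i); exacts [(hY i).aemeasurable, (hZ i).aemeasurable])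
    (by rintro (i | i); exacts [hmemY i, hmemZ i]) hindYZ hA
  obtain ⟨hBi, hBs⟩ := hasSubgaussianMGF_sq_W₂_empiricalMeasure (W := Sum.elim X Z) hn0 hS
    (by rintro (i | i); exacts [(hX i).aemeasurable, (hZ i).aemeasurable])
    (by rintro (i | i); exacts [hmemX i, hmemZ i]) hindXZ hB
  have hU' : U = fun ω => A ω ^ 2 - B ω ^ 2 := hU
  have hL' : L = fun ω => A ω - B ω := hL
  have hA2 : Integrable (fun ω => A ω ^ 2) P := by
    exact (hAs.integrable.add (integrable_const (∫ ω', A ω' ^ 2 ∂P))).congr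
      (ae_of_all _ fun ω => sub_add_cancel _ _)
  have hB2 : Integrable (fun ω => B ω ^ 2) P := by
    exact (hBs.integrable.add (integrable_const (∫ ω', B ω' ^ 2 ∂P))).congr
      (ae_of_all _ fun ω => sub_add_cancel _ _)
  have hnpos : (0 : ℝ) < n := by exact_mod_cast Nat.pos_of_ne_zero hn0
  have hcpos : (0 : NNReal) < (2 * n : NNReal)⁻¹ := by
    have : (0 : NNReal) < n := by exact_mod_cast Nat.pos_of_ne_zero hn0
    positivity
  have hcr : (((2 * n : NNReal)⁻¹ : NNReal) : ℝ) = (2 * n : ℝ)⁻¹ := by push_cast; rfl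
  subst hU' hL'
  refine ⟨hA2.sub hB2, hAi.sub hBi, fun t ht => ⟨?_, ?_⟩⟩
  · have htail : ∀ D : Ω → ℝ, HasSubgaussianMGF D (2 * n : NNReal)⁻¹ P →
        P.real {ω | t / 2 ≤ |D ω|} ≤ 2 * Real.exp (-((n : ℝ) * t ^ 2 / 4)) := by
      intro D hD
      refine (HasSubgaussianMGF.measure_abs_ge_le hD (by positivity)).trans_eq ?_
      rw [hcr]
      congr 2
      field_simp
      ring
    refine (measure_abs_sub_sub_integral_ge_le hA2 hB2 (htail _ hAs) (htail _ hBs)).trans_eq ?_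
    ring
  -- In the small regime the bound is trivial, since `4 * exp (-1) ≥ 1`.
  · rcases le_or_gt ((n : ℝ) * t ^ 4 / 256) 1 with hsmall | hbig
    · refine measureReal_le_one.trans ?_
      have h1 : Real.exp (-1) ≤ Real.exp (-((n : ℝ) * t ^ 4 / 256)) :=
        Real.exp_le_exp.2 (by linarith)
      have h2 : (1 : ℝ) / 4 ≤ Real.exp (-1) := by
        rw [Real.exp_neg, ← one_div]
        exact one_div_le_one_div_of_le (Real.exp_pos _) (by linarith [Real.exp_one_lt_d9])
      linarith
    · have hbig' : 512 * (((2 * n : NNReal)⁻¹ : NNReal) : ℝ) < t ^ 4 := by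
        rw [hcr]
        rw [lt_div_iff₀ (by norm_num)] at hbig
        rw [← div_eq_mul_inv, div_lt_iff₀ (by positivity)]
        linarith
      have hexp : -t ^ 4 / (512 * (((2 * n : NNReal)⁻¹ : NNReal) : ℝ))
          = -((n : ℝ) * t ^ 4 / 256) := by
        rw [hcr]; field_simp; ring
      have hpA := measure_abs_sub_integral_ge_le_of_hasSubgaussianMGF_sq
        (fun ω => ENNReal.toReal_nonneg) hAi hcpos hAs ht hbig'
      have hpB := measure_abs_sub_integral_ge_le_of_hasSubgaussianMGF_sq
        (fun ω => ENNReal.toReal_nonneg) hBi hcpos hBs ht hbig'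
      rw [hexp] at hpA hpB
      refine (measure_abs_sub_sub_integral_ge_le hAi hBi hpA hpB).trans_eq ?_
      ring
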